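/- **Model.** A network is a graph $G=(V,E)$ with finitely many links, directed or undirected, in which every link $e$ has a capacity $C(e)\ge 0$ (in an undirected graph the flows in the two directions of a link share its capacity). A finite or infinite sequence of requests $j$ is given; request $j$ arrives at a time $a_j\ge 0$ and asks to transmit a file of size $f_j>0$ from a node $s_j$ to a node $d_j\neq s_j$. The requests are listed in order of arrival, and only finitely many arrive up to any given time. For a set $L$ of requests let $\mathtt{maxflow}(G,L)\in[0,\infty]$ be the least $T$ such that all files in $L$ can be transmitted concurrently during a time of length $T$ by a multicommodity flow of constant rates (request $j$ having flow value $f_j/T$) whose total rate on each link is at most its capacity ($\infty$ if there is no such $T$). **BatchAll.** A request that arrives when no batch is running and none is pending forms a batch by itself, which starts at once. A batch with request set $L$ lasts for a time $\mathtt{maxflow}(G,L)$, and all its requests are completed at its end. The requests that arrive while a batch is running (strictly before its end) are pending; if there are any when it ends, all of them form the next batch, which starts immediately. **Offline algorithms.** An offline schedule knows all requests in advance and assigns to every request $j$ and every time $\tau$ a flow from $s_j$ to $d_j$, measurable in $\tau$ and zero before $a_j$, such that at all times the total rate on each link is at most its capacity. The waiting time of $j$ is the time from $a_j$ until an amount $f_j$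 has been transmitted. The optimal maximum waiting time is the infimum over all schedules of the supremum of the waiting times of all requests in the sequence. **Theorem.** Let $\varepsilon>0$, and let the augmented network be $G$ with the capacity of every link $e$ replaced by $(1+\varepsilon)C(e)$. Then for every time $t^*$ the maximum time from arrival to completion under BatchAll in the augmented network, over the requests arriving up to time $t^*$, is at most $2/\varepsilon$ times the optimal maximum waiting time in the original network. This holds when both BatchAll and the optimal offline algorithm are given the whole request sequence (the optimal maximum waiting time being taken over all its requests), and also when both are given only the requests that arrive up to time $t^*$. -/

import Mathlib

open scoped NNReal ENNReal

noncomputable section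

namespace AdvanceReservation

/-- A capacitated network on the node set `V` with link set `E`. The graph is directed or
undirected; in the undirected case `src e` and `dst e` are the two ends of `e` in some order. -/
structure Network (V E : Type*) where
  src : E → V
  dst : E → V
  directed : Prop
  cap : E → ℝ
  cap_nonneg : ∀ e, 0 ≤ cap e

/-- A connection request `(s, d, f)`: source, destination different from it, file size. -/
structure Job (V : Type*) where
  source : V
  dest : V
  dest_ne : dest ≠ source
  size : ℝ
  size_pos : 0 < size

/-- A finite or infinite sequence of requests, listed in the order in which they are placed
(the order of `J` matters only for simultaneous arrivals); finitely many arrive by any time. -/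
structure Requests (V J : Type*) [LinearOrder J] where
  job : J → Job V
  arrival : J → ℝ≥0
  arrival_mono : Monotone arrival
  finite_arrivals : ∀ t, {j | arrival j ≤ t}.Finite

/-- The sequence made only of the requests that arrive up to time `t`. -/
def Requests.upTo {V J : Type*} [LinearOrder J] (r : Requests V J) (t : ℝ≥0) :
    Requests V {j : J // r.arrival j ≤ t} where
  job j := r.job j
  arrival j := r.arrival j
  arrival_mono _ _ h := r.arrival_mono h
  finite_arrivals u := (r.finite_arrivals u).preimage Subtype.val_injective.injOn

namespace Network

variable {V E J : Type*}

/-- The network in which the capacity of every link is multiplied by `1 + ε`. -/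
def augment (N : Network V E) (ε : ℝ) (hε : 0 < ε) : Network V E where
  src := N.src
  dst := N.dst
  directed := N.directed
  cap e := (1 + ε) * N.cap e
  cap_nonneg e := mul_nonneg (by linarith) (N.cap_nonneg e)

/-- Node at which link `e` is entered, in the forward (`true`) or backward (`false`) sense. -/
def tail (N : Network V E) (e : E) (b : Bool) : V := if b then N.src e else N.dst e

/-- Node at which link `e` is left, in the forward (`true`) or backward (`false`) sense. -/
def head (N : Network V E) (e : E) (b : Bool) : V := if b then N.dst e else N.src e

open Classical in
/-- Outgoing minus incoming rate at the node `v`, where `x e b` is the rate sent through the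
link `e` in the sense `b`. -/
def netOut [Fintype E] (N : Network V E) (x : E → Bool → ℝ) (v : V) : ℝ :=
  ∑ e, ∑ b, ((if N.tail e b = v then x e b else 0) - (if N.head e b = v then x e b else 0))

/-- `x` is a flow from `s` to `d`; its value is `N.netOut x s`. -/
structure IsFlow [Fintype E] (N : Network V E) (s d : V) (x : E → Bool → ℝ) : Prop where
  nonneg : ∀ e b, 0 ≤ x e b
  oneWay : N.directed → ∀ e, x e false = 0
  conserved : ∀ v, v ≠ s → v ≠ d → N.netOut x v = 0
  value_nonneg : 0 ≤ N.netOut x s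

/-- `multicomm`: constant-rate concurrent flows can transmit all jobs with index in `L` during a
time of length `T`, the total flow through each link not exceeding its capacity. -/
def Multicomm [Fintype E] (N : Network V E) (job : J → Job V) (L : Set J) (T : ℝ≥0) : Prop :=
  ∃ x : J → E → Bool → ℝ,
    (∀ j ∈ L, N.IsFlow (job j).source (job j).dest (x j)) ∧
    (∀ j ∈ L, T * N.netOut (x j) (job j).source = (job j).size) ∧
    (∀ F : Finset J, (F : Set J) ⊆ L → ∀ e, ∑ j ∈ F, (x j e true + x j e false) ≤ N.cap e)

/-- `maxflow`: the least `T` for which `Multicomm` holds, `∞` if there is none. -/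
def maxflow [Fintype E] (N : Network V E) (job : J → Job V) (L : Set J) : ℝ≥0∞ :=
  ⨅ (T : ℝ≥0) (_ : N.Multicomm job L T), (T : ℝ≥0∞)

end Network

section BatchAll

variable {V E J : Type*} [LinearOrder J]

/-- State of `BatchAll` between two batches: the requests that were put into a batch so far, and
the time at which the last of these batches ends. -/
structure BatchState (J : Type*) where
  served : Set J
  clock : ℝ≥0∞

/-- The waiting batch: requests that arrived before the end of the last batch and are in no
batch so far. -/
def BatchState.pending (r : Requests V J) (st : BatchState J) : Set J :=
  {j | j ∉ st.served ∧ (r.arrival j : ℝ≥0∞) < st.clock}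

open Classical in
/-- The next batch: all pending requests or, if there is none, the next request alone. -/
def BatchState.batch (r : Requests V J) (st : BatchState J) : Set J :=
  if (st.pending r).Nonempty then st.pending r else {j | IsLeast st.servedᶜ j}

open Classical in
/-- The next batch starts when the last one ends or, if no request is pending then, at the
arrival of the next request (`∞` if no request is left). -/
def BatchState.start (r : Requests V J) (st : BatchState J) : ℝ≥0∞ :=
  if (st.pending r).Nonempty then st.clock else ⨅ j ∈ st.servedᶜ, (r.arrival j : ℝ≥0∞)

def BatchState.finish [Fintype E] (N : Network V E) (r : Requests V J) (st : BatchState J) :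
    ℝ≥0∞ :=
  st.start r + N.maxflow r.job (st.batch r)

/-- State of `BatchAll` on the network `N` after `k` batches. -/
def batchAllState [Fintype E] (N : Network V E) (r : Requests V J) : ℕ → BatchState J
  | 0 => ⟨∅, 0⟩
  | k + 1 =>
    let st := batchAllState N r k
    ⟨st.served ∪ st.batch r, st.finish N r⟩

/-- Time at which the request `j` is completed under `BatchAll`: the end of its batch. -/
def batchAllCompletion [Fintype E] (N : Network V E) (r : Requests V J) (j : J) : ℝ≥0∞ :=
  ⨅ (k : ℕ) (_ : j ∈ (batchAllState N r k).batch r), (batchAllState N r k).finish N r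

/-- Maximum time from arrival to completion under `BatchAll`, over the requests that arrive up
to time `t`. -/
def batchAllMaxWait [Fintype E] (N : Network V E) (r : Requests V J) (t : ℝ≥0) : ℝ≥0∞ :=
  ⨆ (j : J) (_ : r.arrival j ≤ t), (batchAllCompletion N r j - r.arrival j)

end BatchAll

section Offline

variable {V E J : Type*} [LinearOrder J] [Fintype E]

/-- What an arbitrary (offline) algorithm may do: `rate j τ e b` is the rate at which data of the
request `j` passes the link `e` in the sense `b` at time `τ`. Paths may be split, changed and
interrupted at will. -/
structure Schedule (N : Network V E) (r : Requests V J) where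
  rate : J → ℝ → E → Bool → ℝ
  measurable_rate : ∀ j e b, Measurable fun τ => rate j τ e b
  isFlow : ∀ j τ, N.IsFlow (r.job j).source (r.job j).dest (rate j τ)
  after_arrival : ∀ j τ, τ < r.arrival j → ∀ e b, rate j τ e b = 0
  capacity : ∀ τ (F : Finset J) e, ∑ j ∈ F, (rate j τ e true + rate j τ e false) ≤ N.cap e

/-- Time from the arrival of the request `j` until its whole file has been transmitted (`∞` if
this never happens). -/
def Schedule.wait {N : Network V E} {r : Requests V J} (σ : Schedule N r) (j : J) : ℝ≥0∞ :=
  ⨅ (w : ℝ≥0) (_ : (r.job j).size ≤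
      ∫ τ in (r.arrival j : ℝ)..(r.arrival j + w : ℝ), N.netOut (σ.rate j τ) (r.job j).source),
    (w : ℝ≥0∞)

/-- The maximum waiting time of an optimal offline algorithm. -/
def optMaxWait (N : Network V E) (r : Requests V J) : ℝ≥0∞ :=
  ⨅ σ : Schedule N r, ⨆ j, σ.wait j

end Offline

end AdvanceReservation

end

namespace AdvanceReservation

variable {V E J : Type*}

/-! Let some schedule keep all waits below `w`. Requests arriving in a window of length `d` are then
all transmitted within time `d + w` of its beginning, so averaging the rates over that time gives a
constant-rate multicommodity flow of duration `d + w` (`Schedule.multicomm`), hence of duration `(d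
+ w) / (1 + ε)` after augmentation. For `d ≤ c = w / ε` this is at most `c`. A batch of pending
requests arrived while the previous batch ran, so by induction every batch lasts at most `c`
(`maxflow_batch_le`). A request waits for at most the rest of one batch and then its own, at most `2
* c` in all; let `w` tend to the optimum. The argument works for any request sequence, so also for
the truncated one. -/

theorem intervalIntegrable_finsetSum {ι : Type*} (s : Finset ι) {f : ι → ℝ → ℝ} {a b : ℝ}
    (h : ∀ i ∈ s, IntervalIntegrable (f i) MeasureTheory.volume a b) :
    IntervalIntegrable (fun τ => ∑ i ∈ s, f i τ) MeasureTheory.volume a b := by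
  simpa only [Finset.sum_fn] using IntervalIntegrable.sum s h

/-! ### Linearity of flows: scaling and time integrals -/

namespace Network

theorem netOut_const_mul [Fintype E] (N : Network V E) (c : ℝ) (x : E → Bool → ℝ) (v : V) :
    N.netOut (fun e b => c * x e b) v = c * N.netOut x v := by
  simp only [netOut, Finset.mul_sum, mul_sub, mul_ite, mul_zero]

theorem IsFlow.const_mul [Fintype E] {N : Network V E} {s d : V} {x : E → Bool → ℝ}
    (h : N.IsFlow s d x) {c : ℝ} (hc : 0 ≤ c) : N.IsFlow s d (fun e b => c * x e b) where
  nonneg e b := mul_nonneg hc (h.nonneg e b)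
  oneWay hd e := by simp [h.oneWay hd e]
  conserved v hs hv := by rw [netOut_const_mul, h.conserved v hs hv, mul_zero]
  value_nonneg := by rw [netOut_const_mul]; exact mul_nonneg hc h.value_nonneg

theorem intervalIntegrable_netOut [Fintype E] (N : Network V E) {x : ℝ → E → Bool → ℝ} {a b : ℝ}
    (hx : ∀ e i, IntervalIntegrable (fun τ => x τ e i) MeasureTheory.volume a b) (v : V) :
    IntervalIntegrable (fun τ => N.netOut (x τ) v) MeasureTheory.volume a b := by
  unfold netOut
  refine intervalIntegrable_finsetSum _ fun e _ => intervalIntegrable_finsetSum _ fun i _ => ?_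
  refine IntervalIntegrable.sub ?_ ?_
  · split_ifs
    exacts [hx e i, by simp]
  · split_ifs
    exacts [hx e i, by simp]

theorem netOut_integral [Fintype E] (N : Network V E) {x : ℝ → E → Bool → ℝ} {a b : ℝ}
    (hx : ∀ e i, IntervalIntegrable (fun τ => x τ e i) MeasureTheory.volume a b) (v : V) :
    N.netOut (fun e i => ∫ τ in a..b, x τ e i) v = ∫ τ in a..b, N.netOut (x τ) v := by
  classical
  have hite : ∀ (p : Prop) [Decidable p] (e : E) (i : Bool),
      IntervalIntegrable (fun τ => if p then x τ e i else 0) MeasureTheory.volume a b := by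
    intro p _ e i
    split_ifs
    exacts [hx e i, by simp]
  unfold netOut
  rw [intervalIntegral.integral_finsetSum
    fun e _ => intervalIntegrable_finsetSum _ fun i _ => (hite _ e i).sub (hite _ e i)]
  refine Finset.sum_congr rfl fun e _ => ?_
  rw [intervalIntegral.integral_finsetSum fun i _ => (hite _ e i).sub (hite _ e i)]
  refine Finset.sum_congr rfl fun i _ => ?_
  rw [intervalIntegral.integral_sub (hite _ e i) (hite _ e i)]
  congr 1 <;> split_ifs <;> simp

/-- Flows accumulate to a flow. -/
theorem IsFlow.integral [Fintype E] {N : Network V E} {s d : V} {x : ℝ → E → Bool → ℝ} {a b : ℝ}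
    (hab : a ≤ b) (h : ∀ τ, N.IsFlow s d (x τ))
    (hx : ∀ e i, IntervalIntegrable (fun τ => x τ e i) MeasureTheory.volume a b) :
    N.IsFlow s d (fun e i => ∫ τ in a..b, x τ e i) where
  nonneg e i := intervalIntegral.integral_nonneg hab fun τ _ => (h τ).nonneg e i
  oneWay hd e := by simp [fun τ => (h τ).oneWay hd e]
  conserved v hs hv := by
    rw [netOut_integral N hx]
    simp [fun τ => (h τ).conserved v hs hv]
  value_nonneg := by
    rw [netOut_integral N hx]
    exact intervalIntegral.integral_nonneg hab fun τ _ => (h τ).value_nonneg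

theorem maxflow_le [Fintype E] {N : Network V E} {job : J → Job V} {L : Set J} {T : ℝ≥0}
    (h : N.Multicomm job L T) : N.maxflow job L ≤ T :=
  iInf₂_le T h

theorem Multicomm.augment [Fintype E] {N : Network V E} {job : J → Job V} {L : Set J} {T T' : ℝ≥0}
    (h : N.Multicomm job L T) {ε : ℝ} (hε : 0 < ε) (hT : (T' : ℝ) * (1 + ε) = T) :
    (N.augment ε hε).Multicomm job L T' := by
  obtain ⟨x, hflow, hval, hcap⟩ := h
  have h1 : 0 ≤ 1 + ε := by linarith
  refine ⟨fun j e b => (1 + ε) * x j e b, fun j hj => ?_, fun j hj => ?_, fun F hF e => ?_⟩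
  · have := (hflow j hj).const_mul h1
    exact ⟨this.nonneg, this.oneWay, this.conserved, this.value_nonneg⟩
  · change (T' : ℝ) * N.netOut (fun e b => (1 + ε) * x j e b) _ = _
    rw [netOut_const_mul, ← mul_assoc, hT, hval j hj]
  · simp only [← mul_add, ← Finset.mul_sum]
    exact mul_le_mul_of_nonneg_left (hcap F hF e) h1

end Network

/-! ### From a schedule to a constant-rate flow -/

namespace Schedule

variable [LinearOrder J] [Fintype E] {N : Network V E} {r : Requests V J}

theorem rate_le_cap (σ : Schedule N r) (j : J) (τ : ℝ) (e : E) (b : Bool) :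
    σ.rate j τ e b ≤ N.cap e := by
  have h := σ.capacity τ {j} e
  have h0 := (σ.isFlow j τ).nonneg e
  rw [Finset.sum_singleton] at h
  cases b
  · linarith [h0 true]
  · linarith [h0 false]

theorem intervalIntegrable_rate (σ : Schedule N r) (j : J) (e : E) (i : Bool) (a b : ℝ) :
    IntervalIntegrable (fun τ => σ.rate j τ e i) MeasureTheory.volume a b := by
  refine (intervalIntegrable_const (c := N.cap e)).mono_fun
    (σ.measurable_rate j e i).aestronglyMeasurable (Filter.Eventually.of_forall fun τ => ?_)
  simpa only [Real.norm_eq_abs, abs_of_nonneg ((σ.isFlow j τ).nonneg e i),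
    abs_of_nonneg (N.cap_nonneg e)] using σ.rate_le_cap j τ e i

/-- If a schedule keeps all waiting times below `w`, then requests arriving during a period of
length `d` can be transmitted concurrently in time `d + w`: average the rates of the schedule. -/
theorem multicomm (σ : Schedule N r) {w a d : ℝ≥0} {L : Set J} (hw : ∀ j, σ.wait j < w)
    (hL : ∀ j ∈ L, a ≤ r.arrival j ∧ r.arrival j ≤ a + d) (hw0 : 0 < w) :
    N.Multicomm r.job L (d + w) := by
  set T : ℝ := d + w with hT
  have hTpos : 0 < T := by positivity
  have hab : (a : ℝ) ≤ a + T := by linarith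
  have hint := fun j e i => σ.intervalIntegrable_rate j e i a (a + T)
  set y : J → E → Bool → ℝ := fun j e i => ∫ τ in (a : ℝ)..(a + T), σ.rate j τ e i with hy
  have hyflow : ∀ j, N.IsFlow (r.job j).source (r.job j).dest (y j) := fun j =>
    Network.IsFlow.integral hab (σ.isFlow j) (hint j)
  have hysize : ∀ j ∈ L, (r.job j).size ≤ N.netOut (y j) (r.job j).source := by
    intro j hj
    obtain ⟨v, hv⟩ := iInf_lt_iff.1 (hw j)
    obtain ⟨hsize, hvw⟩ := iInf_lt_iff.1 hv
    have hvw : (v : ℝ) < w := by exact_mod_cast hvw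
    have h1 : (a : ℝ) ≤ r.arrival j := by exact_mod_cast (hL j hj).1
    have h2 : (r.arrival j : ℝ) ≤ a + d := by exact_mod_cast (hL j hj).2
    rw [hy, Network.netOut_integral N (hint j)]
    -- The file is sent within `[arrival, arrival + v]`, which lies inside `[a, a + T]`; enlarging
    -- the interval cannot lose anything, as flow values are nonnegative.
    refine hsize.trans (intervalIntegral.integral_mono_interval h1 (by simp) (by linarith)
      (Filter.Eventually.of_forall fun τ => (σ.isFlow j τ).value_nonneg)
      (Network.intervalIntegrable_netOut N (hint j) _))
  have hycap : ∀ (F : Finset J) e, ∑ j ∈ F, (y j e true + y j e false) ≤ T * N.cap e := by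
    intro F e
    have h1 : ∑ j ∈ F, (y j e true + y j e false)
        = ∫ τ in (a : ℝ)..(a + T), ∑ j ∈ F, (σ.rate j τ e true + σ.rate j τ e false) := by
      rw [intervalIntegral.integral_finsetSum fun j _ => (hint j e true).add (hint j e false)]
      exact Finset.sum_congr rfl fun j _ =>
        (intervalIntegral.integral_add (hint j e true) (hint j e false)).symm
    rw [h1]
    refine (intervalIntegral.integral_mono_on hab
      (intervalIntegrable_finsetSum _ fun j _ => (hint j e true).add (hint j e false))
      intervalIntegrable_const fun τ _ => σ.capacity τ F e).trans ?_
    simp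
  -- The schedule may send more than the file, while `Multicomm` demands the exact size: `q j ≤ 1`
  -- scales the excess away.
  set q : J → ℝ := fun j => (r.job j).size / N.netOut (y j) (r.job j).source with hq
  have hq0 : ∀ j, 0 ≤ q j := fun j => div_nonneg (r.job j).size_pos.le (hyflow j).value_nonneg
  have hq1 : ∀ j ∈ L, q j ≤ 1 := fun j hj =>
    div_le_one_of_le₀ (hysize j hj) (hyflow j).value_nonneg
  refine ⟨fun j e i => T⁻¹ * q j * y j e i, fun j _ => ?_, fun j hj => ?_, fun F hF e => ?_⟩
  · exact (hyflow j).const_mul (mul_nonneg (inv_nonneg.2 hTpos.le) (hq0 j))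
  · have hne : N.netOut (y j) (r.job j).source ≠ 0 :=
      ((r.job j).size_pos.trans_le (hysize j hj)).ne'
    rw [Network.netOut_const_mul, NNReal.coe_add, ← hT, mul_assoc, mul_inv_cancel_left₀ hTpos.ne',
      hq, div_mul_cancel₀ _ hne]
  · calc ∑ j ∈ F, (T⁻¹ * q j * y j e true + T⁻¹ * q j * y j e false)
        ≤ ∑ j ∈ F, T⁻¹ * (y j e true + y j e false) := by
          refine Finset.sum_le_sum fun j hj => ?_
          rw [← mul_add, mul_assoc]
          refine mul_le_mul_of_nonneg_left ?_ (inv_nonneg.2 hTpos.le)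
          exact mul_le_of_le_one_left
            (add_nonneg ((hyflow j).nonneg e true) ((hyflow j).nonneg e false)) (hq1 j (hF hj))
      _ = T⁻¹ * ∑ j ∈ F, (y j e true + y j e false) := (Finset.mul_sum ..).symm
      _ ≤ T⁻¹ * (T * N.cap e) :=
          mul_le_mul_of_nonneg_left (hycap F e) (inv_nonneg.2 hTpos.le)
      _ = N.cap e := inv_mul_cancel_left₀ hTpos.ne' _

end Schedule

/-! ### Timing of the batches -/

section BatchAll

variable [LinearOrder J]

theorem Requests.exists_isLeast (r : Requests V J) {S : Set J} (hS : S.Nonempty) :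
    ∃ i, IsLeast S i := by
  obtain ⟨j, hj⟩ := hS
  obtain ⟨i, ⟨hiS, hij⟩, hmin⟩ := Set.exists_min_image (S ∩ {i | r.arrival i ≤ r.arrival j}) id
    ((r.finite_arrivals _).inter_of_right S) ⟨j, hj, le_refl (r.arrival j)⟩
  refine ⟨i, hiS, fun k hk => ?_⟩
  rcases le_total (r.arrival k) (r.arrival j) with h | h
  · exact hmin k ⟨hk, h⟩
  · rcases le_total k j with hkj | hjk
    · exact hmin k ⟨hk, r.arrival_mono hkj⟩
    · exact (hmin j ⟨hj, le_refl (r.arrival j)⟩).trans hjk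

theorem BatchState.start_le_arrival (r : Requests V J) (st : BatchState J) {j : J}
    (hj : j ∉ st.served) (hjb : j ∉ st.batch r ∨ ¬ (st.pending r).Nonempty) :
    st.start r ≤ r.arrival j := by
  unfold start
  split_ifs with h
  · rcases hjb with hjb | hjb
    · rw [batch, if_pos h] at hjb
      by_contra hlt
      exact hjb ⟨hj, not_le.1 hlt⟩
    · exact absurd h hjb
  · exact iInf₂_le j hj

/-- As long as `j` is not served, each batch contains a request arriving no later than `j`. -/
theorem BatchState.exists_mem_batch (r : Requests V J) (st : BatchState J) {j : J}
    (hj : j ∉ st.served) : ∃ i ∈ st.batch r, i ∉ st.served ∧ r.arrival i ≤ r.arrival j := by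
  unfold batch
  split_ifs with h
  · by_cases hjc : (r.arrival j : ℝ≥0∞) < st.clock
    · exact ⟨j, ⟨hj, hjc⟩, hj, le_rfl⟩
    · obtain ⟨i, hi⟩ := h
      exact ⟨i, hi, hi.1, by exact_mod_cast (hi.2.trans_le (not_lt.1 hjc)).le⟩
  · obtain ⟨i, hi⟩ := r.exists_isLeast (S := st.servedᶜ) ⟨j, hj⟩
    exact ⟨i, hi, hi.1, r.arrival_mono (hi.2 hj)⟩

variable [Fintype E]

/-- Otherwise every batch would serve a new request from the finite set of those arriving no later
than `j`. -/
theorem exists_mem_batch (N : Network V E) (r : Requests V J) (j : J) :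
    ∃ k, j ∈ (batchAllState N r k).batch r ∧ j ∉ (batchAllState N r k).served := by
  by_contra! hcon
  have hns : ∀ k, j ∉ (batchAllState N r k).served := by
    intro k
    induction k with
    | zero => exact Set.notMem_empty j
    | succ k ih => exact fun h => h.elim ih fun hb => ih (hcon k hb)
  set A : Set J := {i | r.arrival i ≤ r.arrival j}
  have hA : A.Finite := r.finite_arrivals _
  have hgrow : ∀ k, k ≤ ((batchAllState N r k).served ∩ A).ncard := by
    intro k
    induction k with
    | zero => exact Nat.zero_le _
    | succ k ih =>
      obtain ⟨i, hib, his, hia⟩ := (batchAllState N r k).exists_mem_batch r (hns k)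
      refine ih.trans_lt (Set.ncard_lt_ncard ?_ (hA.inter_of_right _))
      refine ⟨Set.inter_subset_inter_left _ Set.subset_union_left, fun h => ?_⟩
      exact his (h ⟨Or.inr hib, hia⟩).1
  have := (hgrow (A.ncard + 1)).trans (Set.ncard_le_ncard Set.inter_subset_right hA)
  omega

variable {N : Network V E} {r : Requests V J} {ε : ℝ} (hε : 0 < ε)

/-- If `ε * c` bounds the waiting times of a schedule, no batch lasts longer than `c`. -/
theorem maxflow_batch_le (σ : Schedule N r) {w c : ℝ≥0} (hw : ∀ j, σ.wait j < w) (hw0 : 0 < w)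
    (hc : (c : ℝ) * ε = w) (k : ℕ) :
    (N.augment ε hε).maxflow r.job ((batchAllState (N.augment ε hε) r k).batch r) ≤ c := by
  -- The choice of `c` makes it a fixed point: `c + w = c * (1 + ε)`.
  have key : ∀ (a : ℝ≥0) (L : Set J), (∀ j ∈ L, a ≤ r.arrival j ∧ r.arrival j ≤ a + c) →
      (N.augment ε hε).maxflow r.job L ≤ c := fun a L hL =>
    Network.maxflow_le ((σ.multicomm hw hL hw0).augment hε (by push_cast; linarith))
  have single : ∀ st : BatchState J, ¬ (st.pending r).Nonempty →
      (N.augment ε hε).maxflow r.job (st.batch r) ≤ c := by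
    intro st h
    rw [BatchState.batch, if_neg h]
    by_cases hi : ∃ i, IsLeast st.servedᶜ i
    · obtain ⟨i, hi⟩ := hi
      refine key (r.arrival i) _ fun j hj => ?_
      rw [IsLeast.unique hj hi]
      exact ⟨le_rfl, le_self_add⟩
    -- No request is left: the batch is empty and any window will do.
    · exact key 0 _ fun j hj => absurd ⟨j, hj⟩ hi
  induction k with
  | zero => exact single _ fun ⟨j, hj⟩ => not_lt_zero hj.2
  | succ k ih =>
    by_cases h : ((batchAllState (N.augment ε hε) r (k + 1)).pending r).Nonempty
    · rw [BatchState.batch, if_pos h]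
      -- A request arriving before the start of batch `k` would already have been served by that
      -- batch or an earlier one.
      have hstart : ∀ j ∈ (batchAllState (N.augment ε hε) r (k + 1)).pending r,
          (batchAllState (N.augment ε hε) r k).start r ≤ r.arrival j := fun j hj =>
        BatchState.start_le_arrival r _ (fun hs => hj.1 (Or.inl hs))
          (Or.inl fun hb => hj.1 (Or.inr hb))
      obtain ⟨i, hi⟩ := h
      obtain ⟨a, ha⟩ : ∃ a : ℝ≥0, (a : ℝ≥0∞) = (batchAllState (N.augment ε hε) r k).start r :=
        ⟨_, ENNReal.coe_toNNReal (ne_top_of_le_ne_top ENNReal.coe_ne_top (hstart i hi))⟩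
      refine key a _ fun j hj => ⟨?_, ?_⟩
      · have := hstart j hj
        rw [← ha] at this
        exact_mod_cast this
      · have : (r.arrival j : ℝ≥0∞) ≤ (batchAllState (N.augment ε hε) r k).start r + c :=
          hj.2.le.trans (add_le_add_right ih _)
        rw [← ha] at this
        exact_mod_cast this
    · exact single _ h

theorem batchAllCompletion_le (σ : Schedule N r) {w c : ℝ≥0} (hw : ∀ j, σ.wait j < w)
    (hw0 : 0 < w) (hc : (c : ℝ) * ε = w) (j : J) :
    batchAllCompletion (N.augment ε hε) r j ≤ r.arrival j + (c + c : ℝ≥0) := by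
  obtain ⟨k, hjb, hjs⟩ := exists_mem_batch (N.augment ε hε) r j
  have hD := maxflow_batch_le hε σ hw hw0 hc
  refine (iInf₂_le k hjb).trans ?_
  have hstart : (batchAllState (N.augment ε hε) r k).start r ≤ r.arrival j + c := by
    by_cases h : ((batchAllState (N.augment ε hε) r k).pending r).Nonempty
    · cases k with
      | zero => exact absurd h.some_mem.2 not_lt_zero
      | succ k =>
        rw [BatchState.start, if_pos h]
        exact add_le_add (BatchState.start_le_arrival r _ (fun hs => hjs (Or.inl hs))
          (Or.inl fun hb => hjs (Or.inr hb))) (hD k)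
    · exact (BatchState.start_le_arrival r _ hjs (Or.inr h)).trans le_self_add
  rw [ENNReal.coe_add, ← add_assoc]
  exact add_le_add hstart (hD k)

theorem batchAllMaxWait_augment_le (N : Network V E) (r : Requests V J) (t : ℝ≥0) :
    batchAllMaxWait (N.augment ε hε) r t ≤ ENNReal.ofReal (2 / ε) * optMaxWait N r := by
  have h0 : ENNReal.ofReal (2 / ε) ≠ 0 := by
    rw [Ne, ENNReal.ofReal_eq_zero, not_le]
    positivity
  -- The optimum need not be attained, so it is approached by finite `w` strictly above it;
  -- strictness also gives `0 < w`.
  rw [← ENNReal.div_le_iff' h0 ENNReal.ofReal_ne_top]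
  refine le_of_forall_gt_imp_ge_of_dense fun x hx => ?_
  obtain ⟨w, hw, hwx⟩ := ENNReal.lt_iff_exists_nnreal_btwn.1 hx
  refine le_trans ?_ hwx.le
  obtain ⟨σ, hσ⟩ := iInf_lt_iff.1 hw
  have hw0 : 0 < w := by exact_mod_cast zero_le.trans_lt hw
  obtain ⟨c, hc⟩ : ∃ c : ℝ≥0, (c : ℝ) = w / ε := ⟨⟨w / ε, by positivity⟩, rfl⟩
  have hcc : ((c + c : ℝ≥0) : ℝ≥0∞) = ENNReal.ofReal (2 / ε) * w := by
    rw [← ENNReal.ofReal_coe_nnreal (p := w), ← ENNReal.ofReal_mul (by positivity),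
      ← ENNReal.ofReal_coe_nnreal]
    congr 1
    rw [NNReal.coe_add, hc]
    ring
  rw [ENNReal.div_le_iff' h0 ENNReal.ofReal_ne_top, ← hcc]
  refine iSup₂_le fun j _ => tsub_le_iff_left.2 ?_
  exact batchAllCompletion_le hε σ (fun j => (le_iSup σ.wait j).trans_lt hσ) hw0
    (by rw [hc, div_mul_cancel₀ _ hε.ne']) j

end BatchAll

end AdvanceReservation

theorem mainTheorem1 {V E J : Type*} [Fintype E] [LinearOrder J]
    (N : AdvanceReservation.Network V E) (r : AdvanceReservation.Requests V J)
    (ε : ℝ) (hε : 0 < ε) (t : ℝ≥0) :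
    AdvanceReservation.batchAllMaxWait (N.augment ε hε) r t
        ≤ ENNReal.ofReal (2 / ε) * AdvanceReservation.optMaxWait N r ∧
      AdvanceReservation.batchAllMaxWait (N.augment ε hε) (r.upTo t) t
        ≤ ENNReal.ofReal (2 / ε) * AdvanceReservation.optMaxWait N (r.upTo t) := by
  exact ⟨AdvanceReservation.batchAllMaxWait_augment_le hε N r t,
    AdvanceReservation.batchAllMaxWait_augment_le hε N (r.upTo t) t⟩
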